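/- Let $\mathcal E=(\mathcal X,\mathcal A,\{P_\theta:\theta\in\Theta\})$, $\Theta\neq\emptyset$, be a statistical experiment dominated by a $\sigma$-finite measure, let $T:\mathcal X\to\mathcal T$ be a measurable map into a measurable space (for example the identity map into $\mathcal X$ equipped with a sub-$\sigma$-field of $\mathcal A$, such as the rank $\sigma$-field behind a conformal reduction), and let $\mathcal E_T=\{P_\theta\circ T^{-1}:\theta\in\Theta\}$ be the reduced experiment. A decision rule for an experiment with a finite action set $A$ is a Markov kernel $\rho$ from the sample space to $A$; for a loss $L_\theta:A\to[0,1]$ its risk is $R_\theta(\rho)=\int\!\int L_\theta(a)\,\rho(da\mid x)\,P_\theta(dx)$. The deficiency $\delta(\mathcal F,\mathcal E)$ is the infimum of the $\varepsilon\ge 0$ such that for every finite $A$, every loss $L_\theta:A\to[0,1]$ and every decision rule $\rho$ for $\mathcal E$ there is a decision rule $\sigma$ for $\mathcal F$ with $\sup_\theta\,(R_\theta(\sigma;\mathcal F)-R_\theta(\rho;\mathcal E))\le\varepsilon$. The statistic $T$ is sufficient if every $B\in\mathcal A$ has a version of $P_\theta(B\mid T)$ that does not depend on $\theta$; it is Blackwell-sufficient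 if there is a Markov kernel $\kappa$ from $\mathcal T$ to $\mathcal X$, not depending on $\theta$, with $\kappa\circ(P_\theta\circ T^{-1})=P_\theta$ for all $\theta$. Two experiments are Blackwell-equivalent if each is obtained from the other by a Markov kernel not depending on $\theta$. Then: 1. $\delta(\mathcal E_T,\mathcal E)=0$ if and only if $T$ is sufficient. 2. $T$ is Blackwell-sufficient if and only if $\mathcal E_T$ and $\mathcal E$ are Blackwell-equivalent; if $\mathcal X$ is a standard Borel space (for example $\mathcal Y^n$ with $\mathcal Y$ Polish), this holds if and only if $T$ is sufficient. 3. Suppose that $T$ is not sufficient, or that $\mathcal X$ is standard Borel and $T$ is not Blackwell-sufficient. Then $\delta(\mathcal E_T,\mathcal E)>0$. Moreover there are a finite action set $A$, a loss $L_\theta:A\to[0,1]$, a finitely supported prior $\pi$ on $\Theta$, a full-data decision rule $\rho$ that is Bayes for $\pi$ and admissible, and $\eta>0$, such that every decision rule $\sigma$ based on $T$ is beaten by $\rho$ by at least $\eta$ both in worst-case and in average risk: $$\sup_\theta R_\theta(\rho;\mathcal E)+\eta\le\sup_\theta R_\theta(\sigma;\mathcal E_T),\qquad \sum_\theta\pi(\theta)R_\theta(\rho;\mathcal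 E)+\eta\le\sum_\theta\pi(\theta)R_\theta(\sigma;\mathcal E_T).$$ The same two conclusions hold with $T$ replaced by any statistic $S$ (with values in a measurable space) that is measurable with respect to the $\sigma$-field generated by $T$. -/

import Mathlib

open MeasureTheory ProbabilityTheory

/-- A statistical experiment with parameter set `Θ` and sample space `X`: a family of probability
measures on `X` indexed by `Θ`. -/
structure Experiment (Θ : Type*) (X : Type*) [MeasurableSpace X] where
  law : Θ → Measure X
  isProb : ∀ θ, IsProbabilityMeasure (law θ)

namespace Experiment

variable {Θ X Y Z : Type*} [MeasurableSpace X] [MeasurableSpace Y] [MeasurableSpace Z]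

/-- All the laws are absolutely continuous with respect to one sigma-finite measure. -/
def IsDominated (E : Experiment Θ X) : Prop :=
  ∃ μ : Measure X, SigmaFinite μ ∧ ∀ θ, E.law θ ≪ μ

/-- The experiment induced by a statistic: the laws are the image measures `P_θ ∘ T⁻¹`.
A sub-sigma-field `m` of `X` is the statistic `id` with values in `X` equipped with `m`. -/
noncomputable def reduce (E : Experiment Θ X) (T : X → Y) (hT : Measurable T) :
    Experiment Θ Y where
  law θ := (E.law θ).map T
  isProb θ := by
    have := E.isProb θ
    exact Measure.isProbabilityMeasure_map hT.aemeasurable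

/-- Risk `R_θ(ρ)` at `θ` of the randomized decision rule `ρ` with action set `Fin k`
under the loss `L`. -/
noncomputable def risk (E : Experiment Θ X) {k : ℕ} (L : Θ → Fin k → ℝ)
    (ρ : Kernel X (Fin k)) (θ : Θ) : ℝ :=
  ∫ x, ∫ a, L θ a ∂(ρ x) ∂(E.law θ)

/-- Average risk with respect to finitely supported weights on the parameter set. -/
noncomputable def bayesRisk (E : Experiment Θ X) {k : ℕ} (L : Θ → Fin k → ℝ) (π : Θ →₀ ℝ)
    (ρ : Kernel X (Fin k)) : ℝ :=
  π.sum fun θ w => w * E.risk L ρ θ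

/-- `ρ` is a Bayes rule for `π`: it minimizes the average risk among all decision rules. -/
def IsBayesRule (E : Experiment Θ X) {k : ℕ} (L : Θ → Fin k → ℝ) (π : Θ →₀ ℝ)
    (ρ : Kernel X (Fin k)) : Prop :=
  ∀ ρ' : Kernel X (Fin k), IsMarkovKernel ρ' → E.bayesRisk L π ρ ≤ E.bayesRisk L π ρ'

/-- `ρ` is admissible: no decision rule is at least as good for every parameter and strictly
better for some parameter. -/
def IsAdmissible (E : Experiment Θ X) {k : ℕ} (L : Θ → Fin k → ℝ)
    (ρ : Kernel X (Fin k)) : Prop :=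
  ¬ ∃ ρ' : Kernel X (Fin k), IsMarkovKernel ρ' ∧
    (∀ θ, E.risk L ρ' θ ≤ E.risk L ρ θ) ∧ ∃ θ, E.risk L ρ' θ < E.risk L ρ θ

/-- Le Cam deficiency `δ(F, E)` of `F` with respect to `E`: the infimum of the `ε ≥ 0` such that for
every finite action set (without loss of generality `Fin k`), every loss with values in `[0,1]` and
every decision rule `ρ` for `E` there is a decision rule `σ` for `F` whose risk exceeds that of `ρ`
by at most `ε`, uniformly in the parameter. -/
noncomputable def deficiency (F : Experiment Θ Y) (E : Experiment Θ X) : ℝ :=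
  sInf {ε : ℝ | 0 ≤ ε ∧ ∀ (k : ℕ) (L : Θ → Fin k → ℝ), (∀ θ a, L θ a ∈ Set.Icc (0 : ℝ) 1) →
    ∀ ρ : Kernel X (Fin k), IsMarkovKernel ρ →
      ∃ σ : Kernel Y (Fin k), IsMarkovKernel σ ∧ ∀ θ, F.risk L σ θ - E.risk L ρ θ ≤ ε}

/-- `T` is sufficient: every event has a conditional probability given `T` that does not depend
on the parameter. -/
def IsSufficient (E : Experiment Θ X) (T : X → Y) : Prop :=
  ∀ A : Set X, MeasurableSet A → ∃ g : Y → ℝ, Measurable g ∧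
    ∀ θ, (E.law θ)[A.indicator (fun _ => (1 : ℝ)) | MeasurableSpace.comap T inferInstance]
      =ᵐ[E.law θ] g ∘ T

/-- `E` is a garbling of `F`: one Markov kernel, the same for all parameters, turns the laws of `F`
into those of `E`. -/
def IsGarblingOf (E : Experiment Θ X) (F : Experiment Θ Y) : Prop :=
  ∃ κ : Kernel Y X, IsMarkovKernel κ ∧ ∀ θ, (F.law θ).bind κ = E.law θ

/-- Blackwell equivalence: each experiment is a garbling of the other. -/
def BlackwellEquivalent (E : Experiment Θ X) (F : Experiment Θ Y) : Prop :=
  E.IsGarblingOf F ∧ F.IsGarblingOf E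

/-- `T` is sufficient in the sense of Blackwell: the full experiment can be simulated from the
reduced one by a Markov kernel that does not depend on the parameter. -/
def IsBlackwellSufficient (E : Experiment Θ X) (T : X → Y) (hT : Measurable T) : Prop :=
  E.IsGarblingOf (E.reduce T hT)

/-- There is a decision problem with finitely many actions and a loss with values in `[0,1]` in which
every procedure based on `F` is beaten by one and the same procedure `ρ` based on `E`: its worst-case
risk is smaller than that of every procedure based on `F`, by at least a fixed amount `η > 0`.
Moreover `ρ` is the Bayes rule of a finitely supported prior `π`, it is admissible (and so lies in
every complete class), and it also beats every procedure based on `F` by `η` in the average risk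
for `π`. -/
def Beats (E : Experiment Θ X) (F : Experiment Θ Y) : Prop :=
  ∃ (k : ℕ) (L : Θ → Fin k → ℝ), (∀ θ a, L θ a ∈ Set.Icc (0 : ℝ) 1) ∧
    ∃ (π : Θ →₀ ℝ) (ρ : Kernel X (Fin k)) (c η : ℝ),
      (∀ θ, 0 ≤ π θ) ∧ (π.sum fun _ w => w) = 1 ∧
      IsMarkovKernel ρ ∧ E.IsBayesRule L π ρ ∧ E.IsAdmissible L ρ ∧
      0 < η ∧ (∀ θ, E.risk L ρ θ ≤ c) ∧
      ∀ σ : Kernel Y (Fin k), IsMarkovKernel σ →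
        (∃ θ, c + η ≤ F.risk L σ θ) ∧
        E.bayesRisk L π ρ + η ≤ F.bayesRisk L π σ

end Experiment

/-!
The dominated family `P_θ` is replaced by densities `p_θ = dP_θ/dν` with respect to a countable
mixture `ν = ∑ₙ 2⁻⁽ⁿ⁺¹⁾ P_{s n}` of its members that has the same null sets as the whole family
(`IsDominated.exists_seq`, `mixture`). Everything rests on the Halmos–Savage criterion: `T` is
sufficient if and only if every `p_θ` is `σ(T)`-measurable modulo `ν`
(`HasMeasurableDensities.isSufficient`, `IsSufficient.hasMeasurableDensities`).

If the densities factor through `T`, let `ν` generate the observation, let a kernel `ρ` act on it, and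
take the conditional law of the outcome given `T`. This is a kernel based on `T` whose outcome has the
same law as that of `ρ` under every `P_θ` (`HasMeasurableDensities.exists_bind_eq`). With a finite
outcome space it shows that the deficiency vanishes; with `ρ` the identity of a standard Borel sample
space it shows that `T` is Blackwell sufficient. Conversely a Blackwell sufficient statistic has
deficiency zero, since decision rules can be composed with the reconstruction kernel.

If some `p_θ` is not `σ(T)`-measurable, there is a level `t` such that `{ν[p_θ | T] ≤ t < p_θ}` has
positive measure. The payoff `∫ φ d(P_θ - t ν)` then separates the event `{t < p_θ}` from all tests
`φ` based on `T` (`exists_gap_of_condExp_ne`). The payoff moves uniformly little when `ν` is cut to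
finitely many terms, so that a finitely supported signed combination `∑ c_θ P_θ` already separates
(`exists_signed_gap`). Splitting `c` into its modulus, the prior, and its sign, the loss, gives a
testing problem in which the full data has a strictly smaller Bayes risk. An additive constant in the
loss that depends on `θ` makes the risk of the Bayes test constant, which gives the worst-case
statement; as the loss does not depend on the action off the support of the prior, the Bayes test is
admissible (`beats_reduce_of_signed_gap`). The margin of this problem bounds the deficiency below, so
that deficiency zero forces sufficiency.
-/

namespace Experiment
open Filter Set
open scoped ENNReal Topology

/-! ### Dominated experiments: an equivalent countable mixture and densities -/

section Mixture

/-- Halmos–Savage: a dominated family has a countable subfamily with the same null sets. The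
subfamily exhausts, up to a null set, the union of the supports `{dP_θ/dμ ≠ 0}`: finite unions of
supports come arbitrarily close to the supremum of their `μ`-measures, so that no further support
can stick out of the countable union by a set of positive measure. -/
theorem IsDominated.exists_seq {Θ X : Type*} [MeasurableSpace X] [Nonempty Θ]
    {E : Experiment Θ X} (hE : E.IsDominated) :
    ∃ s : ℕ → Θ, ∀ A, MeasurableSet A → (∀ n, E.law (s n) A = 0) → ∀ θ, E.law θ A = 0 := by
  have := E.isProb
  obtain ⟨μ₀, hμ₀, hμ₀E⟩ := hE
  obtain ⟨μ, hμ, hμ₀μ, -⟩ := exists_isFiniteMeasure_absolutelyContinuous μ₀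
  have hac : ∀ θ, E.law θ ≪ μ := fun θ => (hμ₀E θ).trans hμ₀μ
  let S : Θ → Set X := fun θ => {x | (E.law θ).rnDeriv μ x ≠ 0}
  have hS : ∀ θ, MeasurableSet (S θ) := fun θ =>
    (Measure.measurable_rnDeriv _ _) (measurableSet_singleton 0).compl
  have hnull : ∀ θ A, E.law θ A = 0 ↔ μ (S θ ∩ A) = 0 := fun θ A => by
    conv_lhs => rw [← Measure.withDensity_rnDeriv_eq _ _ (hac θ)]
    exact withDensity_apply_eq_zero (Measure.measurable_rnDeriv _ _)
  -- finite unions of supports whose measure approaches the supremum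
  obtain ⟨u, -, hu, huF⟩ := exists_seq_tendsto_sSup
    (S := Set.range fun F : Finset Θ => μ (⋃ θ ∈ F, S θ)) (Set.range_nonempty _)
    (OrderTop.bddAbove _)
  choose F hF using huF
  obtain ⟨θ₀⟩ := ‹Nonempty Θ›
  obtain ⟨s, hs⟩ := ((countable_iUnion fun n => (F n).countable_toSet).union
    (countable_singleton θ₀)).exists_eq_range ⟨θ₀, by simp⟩
  -- `U` is the union of the supports along `s`, and `μ (S θ \ U) = 0` for every `θ`
  refine ⟨s, fun A hA hsA θ => ?_⟩
  have hFs : ∀ n, ∀ i ∈ F n, ∃ k, s k = i := fun n i hi => by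
    have : i ∈ Set.range s := hs ▸ Or.inl (mem_iUnion.2 ⟨n, hi⟩)
    exact this
  set U : Set X := ⋃ k, S (s k)
  have hUA : μ (U ∩ A) = 0 := by
    rw [iUnion_inter]
    exact measure_iUnion_null fun k => (hnull _ _).1 (hsA k)
  have hbound : ∀ n, μ (S θ \ U) + u n ≤ sSup (Set.range fun F : Finset Θ => μ (⋃ θ ∈ F, S θ)) := by
    classical
    intro n
    have hd : Disjoint (S θ \ U) (⋃ i ∈ F n, S i) := by
      refine disjoint_left.2 fun x hx hx' => hx.2 ?_
      simp only [mem_iUnion] at hx'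
      obtain ⟨i, hi, hxi⟩ := hx'
      obtain ⟨k, rfl⟩ := hFs n i hi
      exact mem_iUnion.2 ⟨k, hxi⟩
    rw [← hF n, ← measure_union hd (Finset.measurableSet_biUnion _ fun i _ => hS i)]
    refine (measure_mono ?_).trans (le_sSup ⟨insert θ (F n), rfl⟩)
    rw [Finset.set_biUnion_insert]
    exact union_subset_union_left _ sdiff_subset
  have hlim := le_of_tendsto' (hu.const_add (μ (S θ \ U))) hbound
  have hfin : sSup (Set.range fun F : Finset Θ => μ (⋃ θ ∈ F, S θ)) ≠ ∞ := by
    refine ne_top_of_le_ne_top (measure_ne_top μ univ) (sSup_le ?_)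
    rintro _ ⟨G, rfl⟩
    exact measure_mono (subset_univ _)
  have hzero : μ (S θ \ U) = 0 := by
    by_contra h
    exact absurd hlim (not_le.2 (by rw [add_comm]; exact ENNReal.lt_add_right hfin h))
  refine (hnull _ _).2 (measure_mono_null (fun x hx => ?_) (measure_union_null hUA hzero))
  by_cases hxU : x ∈ U
  · exact Or.inl ⟨hxU, hx.2⟩
  · exact Or.inr ⟨hx.1, hxU⟩

variable {Θ X Y : Type*} [MeasurableSpace X]

/-- The countable mixture `∑ₙ 2⁻⁽ⁿ⁺¹⁾ P_{s n}` of the laws along the sequence `s`. -/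
noncomputable def mixture (E : Experiment Θ X) (s : ℕ → Θ) : Measure X :=
  Measure.sum fun n => (2⁻¹ : ℝ≥0∞) ^ (n + 1) • E.law (s n)

instance (E : Experiment Θ X) (s : ℕ → Θ) : IsProbabilityMeasure (E.mixture s) := by
  have := E.isProb
  refine ⟨?_⟩
  simp only [mixture, Measure.sum_apply _ MeasurableSet.univ, Measure.smul_apply, measure_univ,
    smul_eq_mul, mul_one]
  exact ENNReal.tsum_geometric_add_one _ |>.trans (by
    rw [ENNReal.one_sub_inv_two, inv_inv]; exact ENNReal.inv_mul_cancel (by simp) (by simp))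

theorem mixture_apply_eq_zero {E : Experiment Θ X} {s : ℕ → Θ} {A : Set X} (hA : MeasurableSet A) :
    E.mixture s A = 0 ↔ ∀ n, E.law (s n) A = 0 := by
  simp [mixture, Measure.sum_apply _ hA]

theorem hasSum_integral_mixture (E : Experiment Θ X) (s : ℕ → Θ) {f : X → ℝ}
    (hf : Integrable f (E.mixture s)) :
    HasSum (fun n => (2⁻¹ : ℝ) ^ (n + 1) * ∫ x, f x ∂E.law (s n)) (∫ x, f x ∂E.mixture s) := by
  have h := hasSum_integral_measure hf
  simp only [integral_smul_measure, ENNReal.toReal_pow, ENNReal.toReal_inv, ENNReal.toReal_ofNat,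
    smul_eq_mul] at h
  exact h

/-- The density of the law at `θ` with respect to `ν`, as a real function. -/
noncomputable def density (E : Experiment Θ X) (ν : Measure X) (θ : Θ) (x : X) : ℝ :=
  ((E.law θ).rnDeriv ν x).toReal

theorem measurable_density (E : Experiment Θ X) (ν : Measure X) (θ : Θ) :
    Measurable (E.density ν θ) :=
  (Measure.measurable_rnDeriv _ _).ennreal_toReal

theorem integrable_density (E : Experiment Θ X) (ν : Measure X) (θ : Θ) :
    Integrable (E.density ν θ) ν := by
  have := E.isProb θ
  exact Measure.integrable_toReal_rnDeriv

theorem integral_mul_density (E : Experiment Θ X) {ν : Measure X} [IsFiniteMeasure ν] {θ : Θ}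
    (h : E.law θ ≪ ν) (f : X → ℝ) :
    ∫ x, f x * E.density ν θ x ∂ν = ∫ x, f x ∂E.law θ := by
  have := E.isProb θ
  rw [← integral_toReal_rnDeriv_mul h]
  simp only [density, mul_comm]

/-- Conditional expectation is self-adjoint: both sides are the integral of the product of the two
conditional expectations. -/
theorem integral_condExp_mul {X : Type*} {m mX : MeasurableSpace X} {ν : Measure X}
    [IsFiniteMeasure ν] (hm : m ≤ mX) {f p : X → ℝ} (hf : Integrable f ν) {R : ℝ}
    (hfR : ∀ᵐ x ∂ν, |f x| ≤ R) (hp : Integrable p ν) :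
    ∫ x, (ν[f|m]) x * p x ∂ν = ∫ x, f x * (ν[p|m]) x ∂ν := by
  have hb := ae_bdd_abs_condExp_of_ae_bdd_abs (m := m) hfR
  have h1 : ν[ν[f|m] * p|m] =ᵐ[ν] ν[f|m] * ν[p|m] :=
    condExp_mul_of_stronglyMeasurable_left stronglyMeasurable_condExp
      (hp.bdd_mul integrable_condExp.aestronglyMeasurable (hb.mono fun x hx => hx)) hp
  have h2 : ν[f * ν[p|m]|m] =ᵐ[ν] ν[f|m] * ν[p|m] :=
    condExp_mul_of_stronglyMeasurable_right stronglyMeasurable_condExp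
      (integrable_condExp.bdd_mul hf.aestronglyMeasurable (hfR.mono fun x hx => hx)) hf
  calc ∫ x, (ν[f|m]) x * p x ∂ν = ∫ x, (ν[ν[f|m] * p|m]) x ∂ν := (integral_condExp hm).symm
    _ = ∫ x, (ν[f * ν[p|m]|m]) x ∂ν := integral_congr_ae (h1.trans h2.symm)
    _ = ∫ x, f x * (ν[p|m]) x ∂ν := integral_condExp hm

end Mixture

/-! ### Sufficiency and factorization of the densities -/

section Factorization

variable {Θ X Y A : Type*} {m mX : MeasurableSpace X} {mY : MeasurableSpace Y}
  {mA : MeasurableSpace A} {E : Experiment Θ X} {ν : Measure X} {s : ℕ → Θ} {T : X → Y}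

/-- The factorization criterion, relative to a dominating measure `ν`: every density `dP_θ/dν` is
`ν`-almost everywhere equal to an `m`-measurable function. This is encoded as invariance under the
conditional expectation given `m`. -/
def HasMeasurableDensities {Θ X : Type*} (m : MeasurableSpace X) {mX : MeasurableSpace X}
    (E : Experiment Θ X) (ν : Measure X) : Prop :=
  ∀ θ, ν[E.density ν θ|m] =ᵐ[ν] E.density ν θ

theorem integral_law_condExp [IsFiniteMeasure ν] (hm : m ≤ mX) {θ : Θ} (hν : E.law θ ≪ ν)
    {f : X → ℝ} (hf : Integrable f ν) {R : ℝ} (hfR : ∀ᵐ x ∂ν, |f x| ≤ R) :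
    ∫ x, (ν[f|m]) x ∂E.law θ = ∫ x, f x * (ν[E.density ν θ|m]) x ∂ν := by
  rw [← integral_mul_density E hν, integral_condExp_mul hm hf hfR (integrable_density E ν θ)]

/-- If the densities are `m`-measurable, the conditional expectation given `m` under `ν` has the
right integrals under every `P_θ`, so it serves all parameters at once. -/
theorem HasMeasurableDensities.integral_condExp_law [IsFiniteMeasure ν]
    (h : E.HasMeasurableDensities m ν) (hm : m ≤ mX) {θ : Θ} (hν : E.law θ ≪ ν)
    {f : X → ℝ} (hf : Integrable f ν) {R : ℝ} (hfR : ∀ᵐ x ∂ν, |f x| ≤ R) :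
    ∫ x, (ν[f|m]) x ∂E.law θ = ∫ x, f x ∂E.law θ := by
  rw [integral_law_condExp hm hν hf hfR, ← integral_mul_density E hν f]
  refine integral_congr_ae ?_
  filter_upwards [h θ] with x hx
  rw [hx]

/-- The conditional probability under `ν` is the common version of the conditional probabilities. -/
theorem HasMeasurableDensities.isSufficient [IsFiniteMeasure ν] (hT : Measurable T)
    (h : E.HasMeasurableDensities (mY.comap T) ν) (hν : ∀ θ, E.law θ ≪ ν) :
    E.IsSufficient T := by
  intro A hA
  have hm : mY.comap T ≤ mX := hT.comap_le
  set a : X → ℝ := A.indicator fun _ => 1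
  have ha : Measurable a := measurable_const.indicator hA
  have ha1 : ∀ x, |a x| ≤ 1 := fun x => by by_cases hx : x ∈ A <;> simp [a, hx]
  have hai : ∀ μ : Measure X, IsFiniteMeasure μ → Integrable a μ := fun μ _ =>
    Integrable.of_bound ha.aestronglyMeasurable 1 (ae_of_all _ ha1)
  obtain ⟨g, hg, hgT⟩ :=
    (stronglyMeasurable_condExp (μ := ν) (m := mY.comap T)
      (f := a)).measurable.exists_eq_measurable_comp
  refine ⟨g, hg, fun θ => ?_⟩
  have := E.isProb θ
  rw [← hgT]
  have hb : ∀ᵐ x ∂E.law θ, ‖(ν[a|mY.comap T]) x‖ ≤ 1 :=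
    (hν θ).ae_le (ae_bdd_abs_condExp_of_ae_bdd_abs (ae_of_all _ ha1))
  have hbi : Integrable (ν[a|mY.comap T]) (E.law θ) :=
    Integrable.of_bound (stronglyMeasurable_condExp.mono hm).aestronglyMeasurable 1 hb
  symm
  refine ae_eq_condExp_of_forall_setIntegral_eq hm (hai _ inferInstance)
    (fun C _ _ => hbi.integrableOn) (fun C hC _ => ?_)
    stronglyMeasurable_condExp.aestronglyMeasurable
  have hCa : ∀ x, |C.indicator a x| ≤ 1 := fun x => by
    by_cases hx : x ∈ C <;> simp [hx, ha1]
  have hCi : Integrable (C.indicator a) ν := (hai ν inferInstance).indicator (hm C hC)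
  rw [← integral_indicator (hm C hC), ← integral_indicator (hm C hC),
    ← h.integral_condExp_law hm (hν θ) hCi (ae_of_all _ hCa)]
  exact integral_congr_ae
    ((hν θ).ae_eq (condExp_indicator (m := mY.comap T) (hai ν inferInstance) hC).symm)

/-- The converse, for the mixture: a common version of the conditional probabilities along `s` is a
version for the mixture as well, and self-adjointness of the conditional expectation turns this into
`∫_A ν[p_θ | T] dν = P_θ(A) = ∫_A p_θ dν` for every event `A`. -/
theorem IsSufficient.hasMeasurableDensities (hT : Measurable T) (hsuff : E.IsSufficient T)
    (hν : ∀ θ, E.law θ ≪ E.mixture s) :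
    E.HasMeasurableDensities (mY.comap T) (E.mixture s) := by
  intro θ
  have hm : mY.comap T ≤ mX := hT.comap_le
  have := E.isProb
  refine Integrable.ae_eq_of_forall_setIntegral_eq _ _ integrable_condExp
    (integrable_density E _ θ) fun A hA _ => ?_
  obtain ⟨g, hg, hgE⟩ := hsuff A hA
  set a : X → ℝ := A.indicator fun _ => 1
  have ha : Measurable a := measurable_const.indicator hA
  have ha1 : ∀ x, |a x| ≤ 1 := fun x => by by_cases hx : x ∈ A <;> simp [a, hx]
  have hai : ∀ μ : Measure X, IsFiniteMeasure μ → Integrable a μ := fun μ _ =>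
    Integrable.of_bound ha.aestronglyMeasurable 1 (ae_of_all _ ha1)
  have hgT : Measurable (g ∘ T) := hg.comp hT
  have hgb : ∀ θ, ∀ᵐ x ∂E.law θ, |(g ∘ T) x| ≤ 1 := fun θ => by
    filter_upwards [hgE θ, ae_bdd_abs_condExp_of_ae_bdd_abs (m := mY.comap T)
      (ae_of_all (E.law θ) ha1)] with x hx hx'
    rwa [← hx]
  have hgbν : ∀ᵐ x ∂E.mixture s, |(g ∘ T) x| ≤ 1 :=
    (mixture_apply_eq_zero (measurableSet_le hgT.abs measurable_const).compl).2
      fun n => hgb (s n)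
  have hgi : Integrable (g ∘ T) (E.mixture s) :=
    Integrable.of_bound hgT.aestronglyMeasurable 1 hgbν
  -- the common version is also a version for the mixture
  have hmix : g ∘ T =ᵐ[E.mixture s] (E.mixture s)[a|mY.comap T] := by
    refine ae_eq_condExp_of_forall_setIntegral_eq hm (hai _ inferInstance)
      (fun C _ _ => hgi.integrableOn) (fun C hC _ => ?_)
      (hg.comp (comap_measurable T)).stronglyMeasurable.aestronglyMeasurable
    rw [← integral_indicator (hm C hC), ← integral_indicator (hm C hC)]
    refine (hasSum_integral_mixture E s (hgi.indicator (hm C hC))).unique ?_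
    convert hasSum_integral_mixture E s ((hai _ inferInstance).indicator (hm C hC)) using 3 with n
    rw [integral_indicator (hm C hC), integral_indicator (hm C hC),
      ← setIntegral_condExp hm (hai _ inferInstance) hC]
    exact setIntegral_congr_ae (hm C hC) ((hgE (s n)).mono fun x hx _ => hx.symm)
  have key : ∀ f : X → ℝ, ∫ x in A, f x ∂E.mixture s = ∫ x, a x * f x ∂E.mixture s := fun f => by
    rw [← integral_indicator hA]
    congr 1 with x
    by_cases hx : x ∈ A <;> simp [a, hx]
  rw [key, key, ← integral_law_condExp hm (hν θ) (hai _ inferInstance) (ae_of_all _ ha1),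
    integral_mul_density E (hν θ), ← integral_condExp (μ := E.law θ) hm (f := a)]
  exact integral_congr_ae (((hν θ).ae_eq hmix.symm).trans (hgE θ).symm)

/-- If the densities factor through `T`, every kernel `ρ` on the sample space is matched by a kernel
based on `T` with the same output law for every parameter. The matching kernel is the conditional
law of the output given `T` when the observation is drawn from `ν`. For `ρ = id` it is a
reconstruction of the observation; for a finite output space it is a decision rule with the same
risk function. -/
theorem HasMeasurableDensities.exists_bind_eq [IsProbabilityMeasure ν] [StandardBorelSpace A]
    [Nonempty A] (hT : Measurable T) (h : E.HasMeasurableDensities (mY.comap T) ν)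
    (hν : ∀ θ, E.law θ ≪ ν) (ρ : Kernel X A) [IsMarkovKernel ρ] :
    ∃ σ : Kernel Y A, IsMarkovKernel σ ∧
      ∀ θ, ((E.law θ).map T).bind σ = (E.law θ).bind ρ := by
  have hm : mY.comap T ≤ mX := hT.comap_le
  have := E.isProb
  let σ : Kernel Y A := condDistrib Prod.snd (T ∘ Prod.fst) (ν ⊗ₘ ρ)
  refine ⟨σ, inferInstance, fun θ => ?_⟩
  ext D hD
  rw [Measure.bind_apply hD σ.measurable.aemeasurable,
    Measure.bind_apply hD ρ.measurable.aemeasurable,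
    lintegral_map (σ.measurable_coe hD) hT]
  have hσm : Measurable fun x => σ (T x) D := (σ.measurable_coe hD).comp hT
  -- the conditional law of the action given the statistic averages the rule over the fibres
  have hset : ∀ C, MeasurableSet C →
      ∫⁻ x in T ⁻¹' C, σ (T x) D ∂ν = ∫⁻ x in T ⁻¹' C, ρ x D ∂ν := fun C hC => by
    have h1 := setLIntegral_preimage_condDistrib (μ := ν ⊗ₘ ρ) (X := T ∘ Prod.fst)
      (Y := Prod.snd) (hT.comp measurable_fst) measurable_snd.aemeasurable hD hC
    have h2 : (T ∘ Prod.fst) ⁻¹' C ∩ Prod.snd ⁻¹' D = (T ⁻¹' C) ×ˢ D := rfl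
    have h3 : (T ∘ Prod.fst) ⁻¹' C = Prod.fst (β := A) ⁻¹' (T ⁻¹' C) := rfl
    rw [h2, Measure.compProd_apply_prod (hT hC) hD] at h1
    rw [← h1, h3]
    conv_lhs => rw [← Measure.fst_compProd ν ρ]
    rw [Measure.fst, setLIntegral_map (hT hC) hσm measurable_fst]
    rfl
  have hle : ∀ (κ : Kernel X A) [IsMarkovKernel κ] x, |(κ x D).toReal| ≤ 1 := fun κ _ x => by
    rw [abs_of_nonneg ENNReal.toReal_nonneg]
    exact measureReal_le_one (μ := κ x)
  have hρi : Integrable (fun x => (ρ x D).toReal) ν :=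
    Integrable.of_bound (ρ.measurable_coe hD).ennreal_toReal.aestronglyMeasurable 1
      (ae_of_all _ (hle ρ))
  have hσi : Integrable (fun x => (σ (T x) D).toReal) ν :=
    Integrable.of_bound hσm.ennreal_toReal.aestronglyMeasurable 1
      (ae_of_all _ (hle (σ.comap T hT)))
  have hcond : (fun x => (σ (T x) D).toReal) =ᵐ[ν] ν[fun x => (ρ x D).toReal|mY.comap T] := by
    refine ae_eq_condExp_of_forall_setIntegral_eq hm hρi (fun _ _ _ => hσi.integrableOn) ?_
      ((σ.measurable_coe hD).ennreal_toReal.comp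
        (comap_measurable T)).stronglyMeasurable.aestronglyMeasurable
    rintro _ ⟨C, hC, rfl⟩ -
    rw [integral_toReal hσm.aemeasurable (ae_of_all _ fun x => measure_lt_top _ _),
      integral_toReal (ρ.measurable_coe hD).aemeasurable (ae_of_all _ fun x => measure_lt_top _ _),
      hset C hC]
  have hfin : ∀ (κ : Kernel X A) [IsMarkovKernel κ], ∫⁻ x, κ x D ∂E.law θ ≠ ∞ := fun κ _ =>
    ne_top_of_le_ne_top ENNReal.one_ne_top <|
      (lintegral_mono fun x => prob_le_one).trans_eq (by simp)
  refine (ENNReal.toReal_eq_toReal_iff' (hfin (σ.comap T hT)) (hfin ρ)).1 ?_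
  change (∫⁻ x, σ (T x) D ∂E.law θ).toReal = _
  rw [← integral_toReal hσm.aemeasurable (ae_of_all _ fun x => measure_lt_top _ _),
    ← integral_toReal (ρ.measurable_coe hD).aemeasurable (ae_of_all _ fun x => measure_lt_top _ _),
    ← h.integral_condExp_law hm (hν θ) hρi (ae_of_all _ (hle ρ))]
  exact integral_congr_ae ((hν θ).ae_eq hcond)

end Factorization

/-! ### Separation by a finite signed combination of the laws -/

section Gap

/-- If `p` is not `m`-measurable modulo `ν`, then for a suitable level `t` the best `m`-measurable
weight collects strictly less of the payoff `p - t` than the set `{t < p}` does. The deficit `η`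
does not depend on the weight: it is the payoff of `{t < p}` minus that of `{t < ν[p | m]}`. -/
theorem exists_gap_of_condExp_ne {X : Type*} {m mX : MeasurableSpace X} {ν : Measure X}
    [IsFiniteMeasure ν] (hm : m ≤ mX) {p : X → ℝ} (hpm : Measurable p) (hp : Integrable p ν)
    (hne : ¬ ν[p|m] =ᵐ[ν] p) :
    ∃ (t η : ℝ) (B : Set X), 0 < η ∧ MeasurableSet B ∧ ∀ φ : X → ℝ, Measurable[m] φ →
      (∀ x, φ x ∈ Icc (0 : ℝ) 1) →
      ∫ x, φ x * (p x - t) ∂ν + η ≤ ∫ x in B, (p x - t) ∂ν := by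
  set q := ν[p|m] with hq
  have hqm : StronglyMeasurable[m] q := stronglyMeasurable_condExp
  have hqi : Integrable q ν := integrable_condExp
  -- a rational level separates `q` from `p` on a set of positive measure
  obtain ⟨t, ht⟩ : ∃ t : ℚ, ν {x | q x ≤ t ∧ t < p x} ≠ 0 := by
    by_contra! hall
    refine hne ?_
    have hpq : ∀ᵐ x ∂ν, p x ≤ q x := by
      have : ∀ᵐ x ∂ν, ∀ t : ℚ, ¬ (q x ≤ t ∧ t < p x) :=
        ae_all_iff.2 fun t => by simpa [ae_iff] using hall t
      filter_upwards [this] with x hx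
      by_contra! hlt
      obtain ⟨t, ht1, ht2⟩ := exists_rat_btwn hlt
      exact hx t ⟨ht1.le, ht2⟩
    exact ((integral_eq_iff_of_ae_le hp hqi hpq).1 (integral_condExp hm).symm).symm
  have hpt : Integrable (fun x => p x - (t : ℝ)) ν := hp.sub (integrable_const _)
  have hqt : Integrable (fun x => q x - (t : ℝ)) ν := hqi.sub (integrable_const _)
  have hB : MeasurableSet {x | (t : ℝ) < p x} := measurableSet_lt measurable_const hpm
  have hG : MeasurableSet[m] {x | (t : ℝ) < q x} :=
    hqm.measurable measurableSet_Ioi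
  -- weights measurable for `m` see only `q`
  have hproj : ∀ φ : X → ℝ, Measurable[m] φ → (∀ x, φ x ∈ Icc (0 : ℝ) 1) →
      ∫ x, φ x * (p x - t) ∂ν = ∫ x, φ x * (q x - t) ∂ν := fun φ hφ hφ1 => by
    have hb : ∀ᵐ x ∂ν, ‖φ x‖ ≤ 1 := ae_of_all _ fun x => by
      rw [Real.norm_of_nonneg (hφ1 x).1]; exact (hφ1 x).2
    have hφs : AEStronglyMeasurable φ ν := (hφ.mono hm le_rfl).aestronglyMeasurable
    have hφi : Integrable φ ν := Integrable.of_bound hφs 1 hb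
    have h1 : ∫ x, φ x * p x ∂ν = ∫ x, φ x * q x ∂ν := by
      rw [← integral_condExp_mul hm hφi hb hp,
        condExp_of_stronglyMeasurable hm hφ.stronglyMeasurable hφi]
    simp only [mul_sub]
    rw [integral_sub (hp.bdd_mul hφs hb) (hφi.mul_const _),
      integral_sub (hqi.bdd_mul hφs hb) (hφi.mul_const _), h1]
  set η := ∫ x in {x | (t : ℝ) < p x}, (p x - t) ∂ν - ∫ x in {x | (t : ℝ) < q x}, (p x - t) ∂ν
    with hη
  have hηpos : 0 < η := by
    rw [hη, ← integral_indicator hB, ← integral_indicator (hm _ hG),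
      ← integral_sub (hpt.indicator hB) (hpt.indicator (hm _ hG))]
    have hnn : ∀ x, 0 ≤ {x | (t : ℝ) < p x}.indicator (fun x => p x - (t : ℝ)) x -
        {x | (t : ℝ) < q x}.indicator (fun x => p x - (t : ℝ)) x := fun x => by
      simp only [indicator_apply, mem_ofPred_eq]
      split_ifs <;> linarith
    rw [integral_pos_iff_support_of_nonneg hnn ((hpt.indicator hB).sub (hpt.indicator (hm _ hG)))]
    refine (pos_iff_ne_zero.2 ht).trans_le (measure_mono fun x hx => ?_)
    have h1 : (t : ℝ) < p x := hx.2
    have h2 : ¬ (t : ℝ) < q x := not_lt.2 hx.1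
    simp only [Function.mem_support, indicator_apply, mem_ofPred_eq, h1, h2, if_true, if_false]
    linarith
  refine ⟨t, η, _, hηpos, hB, fun φ hφ hφ1 => ?_⟩
  have hb : ∀ᵐ x ∂ν, ‖φ x‖ ≤ 1 := ae_of_all _ fun x => by
    rw [Real.norm_of_nonneg (hφ1 x).1]; exact (hφ1 x).2
  have hφs : AEStronglyMeasurable φ ν := (hφ.mono hm le_rfl).aestronglyMeasurable
  have h2 : ∫ x, φ x * (q x - t) ∂ν ≤ ∫ x in {x | (t : ℝ) < q x}, (q x - t) ∂ν := by
    rw [← integral_indicator (hm _ hG)]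
    refine integral_mono (hqt.bdd_mul hφs hb) (hqt.indicator (hm _ hG)) fun x => ?_
    simp only [indicator_apply, mem_ofPred_eq]
    split_ifs with h
    · nlinarith [(hφ1 x).2]
    · nlinarith [(hφ1 x).1]
  have h3 : ∫ x in {x | (t : ℝ) < q x}, (q x - t) ∂ν =
      ∫ x in {x | (t : ℝ) < q x}, (p x - t) ∂ν := by
    rw [integral_sub hqi.integrableOn (integrable_const _),
      integral_sub hp.integrableOn (integrable_const _), setIntegral_condExp hm hp hG]
  rw [hproj φ hφ hφ1]
  linarith

variable {Θ X : Type*} {m mX : MeasurableSpace X} {E : Experiment Θ X} {s : ℕ → Θ}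

/-- The first `n` terms of the mixture approximate it uniformly over all `[0,1]`-valued functions. -/
theorem abs_integral_mixture_sub_le (E : Experiment Θ X) (s : ℕ → Θ) {ψ : X → ℝ}
    (hψ : Measurable ψ) (hψ1 : ∀ x, ψ x ∈ Icc (0 : ℝ) 1) (n : ℕ) :
    |∫ x, ψ x ∂E.mixture s - ∑ i ∈ Finset.range n, (2⁻¹ : ℝ) ^ (i + 1) * ∫ x, ψ x ∂E.law (s i)|
      ≤ (2⁻¹ : ℝ) ^ n := by
  have := E.isProb
  have hi : ∀ μ : Measure X, IsProbabilityMeasure μ → Integrable ψ μ := fun μ _ =>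
    Integrable.of_bound hψ.aestronglyMeasurable 1 (ae_of_all _ fun x => by
      rw [Real.norm_of_nonneg (hψ1 x).1]; exact (hψ1 x).2)
  have h0 : ∀ i, 0 ≤ ∫ x, ψ x ∂E.law (s i) := fun i => integral_nonneg fun x => (hψ1 x).1
  have h1 : ∀ i, ∫ x, ψ x ∂E.law (s i) ≤ 1 := fun i =>
    (integral_mono (hi _ inferInstance) (integrable_const 1) fun x => (hψ1 x).2).trans (by simp)
  have hs := hasSum_integral_mixture E s (hi _ inferInstance)
  have htail := (hasSum_nat_add_iff' n).2 hs
  have hgeo : HasSum (fun i => (2⁻¹ : ℝ) ^ (i + n + 1)) ((2⁻¹ : ℝ) ^ n) := by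
    have h := (hasSum_geometric_of_lt_one (r := (2⁻¹ : ℝ)) (by norm_num) (by norm_num)).mul_left
      ((2⁻¹ : ℝ) ^ (n + 1))
    have hval : (2⁻¹ : ℝ) ^ (n + 1) * (1 - 2⁻¹)⁻¹ = 2⁻¹ ^ n := by
      rw [show (1 - 2⁻¹ : ℝ) = 2⁻¹ by norm_num, pow_succ, mul_assoc,
        mul_inv_cancel₀ (by norm_num), mul_one]
    rw [hval] at h
    exact h.congr_fun fun i => by ring
  rw [abs_of_nonneg (htail.nonneg fun i => mul_nonneg (by positivity) (h0 _))]
  exact hasSum_le (fun i => mul_le_of_le_one_right (by positivity) (h1 _)) htail hgeo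

/-- If some density with respect to the mixture does not factor through `m`, then a finitely supported
signed combination `∑ c_θ P_θ` of the laws separates full-data tests from `m`-measurable ones: it
gives some event a value exceeding, by a fixed amount, its integral of every `m`-measurable test.
The combination is `P_θ` minus `t` times a finite part of the mixture. -/
theorem exists_signed_gap (hm : m ≤ mX) (hν : ∀ θ, E.law θ ≪ E.mixture s)
    (h : ¬ E.HasMeasurableDensities m (E.mixture s)) :
    ∃ (c : Θ →₀ ℝ) (η : ℝ) (B : Set X), 0 < η ∧ MeasurableSet B ∧
      ∀ φ : X → ℝ, Measurable[m] φ → (∀ x, φ x ∈ Icc (0 : ℝ) 1) →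
        (c.sum fun θ w => w * ∫ x, φ x ∂E.law θ) + η ≤ c.sum fun θ w => w * (E.law θ).real B := by
  have := E.isProb
  obtain ⟨θ, hθ⟩ := not_forall.1 h
  obtain ⟨t, η, B, hη, hB, hgap⟩ := exists_gap_of_condExp_ne hm (measurable_density E _ θ)
    (integrable_density E _ θ) hθ
  obtain ⟨n, hn⟩ := exists_pow_lt_of_lt_one (show 0 < η / (4 * (|t| + 1)) by positivity)
    (show (2⁻¹ : ℝ) < 1 by norm_num)
  let c : Θ →₀ ℝ := Finsupp.single θ 1 -
    t • ∑ i ∈ Finset.range n, Finsupp.single (s i) ((2⁻¹ : ℝ) ^ (i + 1))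
  have hcsum : ∀ F : Θ → ℝ, (c.sum fun θ w => w * F θ) =
      F θ - t * ∑ i ∈ Finset.range n, (2⁻¹ : ℝ) ^ (i + 1) * F (s i) := fun F => by
    have hlin : ∀ d : Θ →₀ ℝ, (d.sum fun θ w => w * F θ) = Finsupp.linearCombination ℝ F d :=
      fun d => by simp [Finsupp.linearCombination_apply]
    rw [hlin]
    simp [c, map_sub, map_smul, map_sum, Finsupp.linearCombination_single]
  -- replacing the mixture by a finite part changes every payoff by at most `η / 4`
  have happrox : ∀ ψ : X → ℝ, Measurable ψ → (∀ x, ψ x ∈ Icc (0 : ℝ) 1) →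
      |∫ x, ψ x * (E.density (E.mixture s) θ x - t) ∂E.mixture s -
        c.sum fun θ w => w * ∫ x, ψ x ∂E.law θ| ≤ η / 4 := fun ψ hψ hψ1 => by
    have hb : ∀ᵐ x ∂E.mixture s, ‖ψ x‖ ≤ 1 := ae_of_all _ fun x => by
      rw [Real.norm_of_nonneg (hψ1 x).1]; exact (hψ1 x).2
    have hψi := Integrable.of_bound hψ.aestronglyMeasurable 1 hb
    rw [hcsum]
    simp only [mul_sub]
    rw [integral_sub ((integrable_density E _ θ).bdd_mul hψ.aestronglyMeasurable hb)
      (hψi.mul_const _), integral_mul_density E (hν θ), integral_mul_const]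
    have h1 := abs_integral_mixture_sub_le E s hψ hψ1 n
    rw [show ∀ a b d : ℝ, a - b * t - (a - t * d) = -(t * (b - d)) by intros; ring, abs_neg,
      abs_mul]
    have h2 : η / 4 = (|t| + 1) * (η / (4 * (|t| + 1))) := by field_simp
    rw [h2]
    exact mul_le_mul (by linarith) (h1.trans hn.le) (abs_nonneg _) (by positivity)
  refine ⟨c, η / 2, B, by positivity, hB, fun φ hφ hφ1 => ?_⟩
  have hB1 : ∀ x, B.indicator (fun _ => (1 : ℝ)) x ∈ Icc (0 : ℝ) 1 := fun x => by
    by_cases hx : x ∈ B <;> simp [hx]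
  have e1 := abs_le.1 (happrox φ (hφ.mono hm le_rfl) hφ1)
  have e2 := abs_le.1 (happrox _ (measurable_const.indicator hB) hB1)
  have e3 := hgap φ hφ hφ1
  have e4 : ∫ x, B.indicator (fun _ => (1 : ℝ)) x * (E.density (E.mixture s) θ x - t) ∂E.mixture s
      = ∫ x in B, (E.density (E.mixture s) θ x - t) ∂E.mixture s := by
    rw [← integral_indicator hB]
    congr 1 with x
    by_cases hx : x ∈ B <;> simp [hx]
  have e5 : ∀ θ, ∫ x, B.indicator (fun _ => (1 : ℝ)) x ∂E.law θ = (E.law θ).real B := fun θ => by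
    rw [integral_indicator_const _ hB, smul_eq_mul, mul_one]
  rw [e4] at e2
  simp only [e5] at e2
  linarith [e1.1, e1.2, e2.1, e2.2]

end Gap

/-! ### Decision problems and deficiency -/

section Decision

variable {Θ X Y : Type*} [MeasurableSpace X] [MeasurableSpace Y] {E : Experiment Θ X}
  {F : Experiment Θ Y}

/-- The risk depends on a rule only through the law of the chosen action. -/
theorem risk_eq_integral_bind {k : ℕ} (L : Θ → Fin k → ℝ) (ρ : Kernel X (Fin k))
    [IsMarkovKernel ρ] (θ : Θ) : E.risk L ρ θ = ∫ a, L θ a ∂(E.law θ).bind ρ := by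
  have := E.isProb θ
  rw [risk, Measure.comp_eq_comp_const_apply, Kernel.integral_comp Integrable.of_finite]
  simp

theorem risk_mem_Icc {k : ℕ} {L : Θ → Fin k → ℝ} (hL : ∀ θ a, L θ a ∈ Icc (0 : ℝ) 1)
    (ρ : Kernel X (Fin k)) [IsMarkovKernel ρ] (θ : Θ) : E.risk L ρ θ ∈ Icc (0 : ℝ) 1 := by
  have := E.isProb θ
  rw [risk_eq_integral_bind]
  exact ⟨integral_nonneg fun a => (hL θ a).1,
    (integral_mono Integrable.of_finite (integrable_const 1) fun a => (hL θ a).2).trans (by simp)⟩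

theorem measurable_real_kernel {k : ℕ} (σ : Kernel Y (Fin k)) (a : Fin k) :
    Measurable fun y => (σ y).real {a} :=
  (σ.measurable_coe (measurableSet_singleton a)).ennreal_toReal

theorem deficiency_eq_zero_of_forall_exists_bind_eq
    (h : ∀ (k : ℕ) (ρ : Kernel X (Fin k)), IsMarkovKernel ρ →
      ∃ σ : Kernel Y (Fin k), IsMarkovKernel σ ∧ ∀ θ, (F.law θ).bind σ = (E.law θ).bind ρ) :
    deficiency F E = 0 := by
  refine IsLeast.csInf_eq ⟨⟨le_rfl, fun k L _ ρ hρ => ?_⟩, fun ε hε => hε.1⟩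
  obtain ⟨σ, hσ, hσρ⟩ := h k ρ hρ
  refine ⟨σ, hσ, fun θ => ?_⟩
  rw [risk_eq_integral_bind, risk_eq_integral_bind, hσρ, sub_self]

theorem IsGarblingOf.deficiency_eq_zero (h : E.IsGarblingOf F) : deficiency F E = 0 := by
  obtain ⟨κ, hκ, hκE⟩ := h
  refine deficiency_eq_zero_of_forall_exists_bind_eq fun k ρ hρ =>
    ⟨ρ ∘ₖ κ, inferInstance, fun θ => ?_⟩
  rw [← hκE, Measure.comp_assoc]

theorem reduce_isGarblingOf {T : X → Y} (hT : Measurable T) : (E.reduce T hT).IsGarblingOf E :=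
  ⟨Kernel.deterministic T hT, inferInstance, fun _ => Measure.deterministic_comp_eq_map hT⟩

/-- The margin `η` of a decision problem won by `E` is a lower bound for the deficiency. The set
whose infimum is the deficiency contains `1`, so that this infimum is not the junk value of the empty
set. -/
theorem Beats.deficiency_pos [Nonempty Θ] (h : E.Beats F) : 0 < deficiency F E := by
  obtain ⟨k, L, hL, π, ρ, c, η, -, -, hρ, -, -, hη, hc, hσ⟩ := h
  refine hη.trans_le (le_csInf ⟨1, zero_le_one, fun k L hL ρ hρ => ?_⟩ fun ε hε => ?_)
  · obtain ⟨θ⟩ := ‹Nonempty Θ›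
    have := E.isProb θ
    obtain ⟨x⟩ := nonempty_of_isProbabilityMeasure (E.law θ)
    obtain ⟨a⟩ := nonempty_of_isProbabilityMeasure (ρ x)
    refine ⟨Kernel.const Y (Measure.dirac a), inferInstance, fun θ => ?_⟩
    linarith [(risk_mem_Icc (E := F) hL (Kernel.const Y (Measure.dirac a)) θ).2,
      (risk_mem_Icc (E := E) hL ρ θ).1]
  · obtain ⟨σ, hσM, hσε⟩ := hε.2 k L hL ρ hρ
    obtain ⟨θ, hθ⟩ := (hσ σ hσM).1
    linarith [hσε θ, hc θ]

/-- Hahn decomposition in terms of densities: the event where `∑ c_θ dP_θ/dν` is positive is an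
optimal test for the signed measure `∑ c_θ P_θ`. -/
theorem exists_optimal_set {ν : Measure X} [IsFiniteMeasure ν] (hν : ∀ θ, E.law θ ≪ ν)
    (c : Θ →₀ ℝ) : ∃ B : Set X, MeasurableSet B ∧
      ∀ ψ : X → ℝ, Measurable ψ → (∀ x, ψ x ∈ Icc (0 : ℝ) 1) →
        (c.sum fun θ w => w * ∫ x, ψ x ∂E.law θ) ≤ c.sum fun θ w => w * (E.law θ).real B := by
  have := E.isProb
  let r : X → ℝ := fun x => c.sum fun θ w => w * E.density ν θ x
  have hr : Measurable r :=
    Finset.measurable_sum _ fun θ _ => (measurable_density E ν θ).const_mul _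
  have hri : Integrable r ν :=
    integrable_finsetSum _ fun θ _ => (integrable_density E ν θ).const_mul _
  have hB : MeasurableSet {x | 0 < r x} := measurableSet_lt measurable_const hr
  have hbound : ∀ ψ : X → ℝ, (∀ x, ψ x ∈ Icc (0 : ℝ) 1) → ∀ᵐ x ∂ν, ‖ψ x‖ ≤ 1 := fun ψ hψ1 =>
    ae_of_all _ fun x => by rw [Real.norm_of_nonneg (hψ1 x).1]; exact (hψ1 x).2
  have hpay : ∀ ψ : X → ℝ, Measurable ψ → (∀ x, ψ x ∈ Icc (0 : ℝ) 1) →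
      (c.sum fun θ w => w * ∫ x, ψ x ∂E.law θ) = ∫ x, ψ x * r x ∂ν := fun ψ hψ hψ1 => by
    simp only [r, Finsupp.sum, Finset.mul_sum]
    rw [integral_finsetSum]
    · refine Finset.sum_congr rfl fun θ _ => ?_
      rw [← integral_mul_density E (hν θ), ← integral_const_mul]
      congr 1 with x
      ring
    · exact fun θ _ => ((integrable_density E ν θ).const_mul _).bdd_mul
        hψ.aestronglyMeasurable (hbound ψ hψ1)
  refine ⟨_, hB, fun ψ hψ hψ1 => ?_⟩
  have hB1 : ∀ x, {x | 0 < r x}.indicator (fun _ => (1 : ℝ)) x ∈ Icc (0 : ℝ) 1 := fun x => by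
    by_cases hx : x ∈ {x | 0 < r x} <;> simp [hx]
  have hBm : Measurable ({x | 0 < r x}.indicator fun _ => (1 : ℝ)) := measurable_const.indicator hB
  have hreal : ∀ θ, (E.law θ).real {x | 0 < r x} =
      ∫ x, {x | 0 < r x}.indicator (fun _ => (1 : ℝ)) x ∂E.law θ := fun θ => by
    rw [integral_indicator_const _ hB, smul_eq_mul, mul_one]
  simp only [hreal]
  rw [hpay ψ hψ hψ1, hpay _ hBm hB1]
  refine integral_mono (hri.bdd_mul hψ.aestronglyMeasurable (hbound ψ hψ1))
    (hri.bdd_mul hBm.aestronglyMeasurable (hbound _ hB1)) fun x => ?_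
  simp only [indicator_apply, mem_ofPred_eq]
  split_ifs with h
  · nlinarith [(hψ1 x).2]
  · nlinarith [(hψ1 x).1]

/-- The loss of the two-action problem attached to a signed combination `c`. The action `1` is
rewarded where `c θ > 0` and penalized where `c θ < 0`. The offset `β θ` is meant to be the
probability with which a given test chooses `1` at `θ`: that test then has risk `1/2` at every
parameter. Where `c θ = 0` the loss is constant. -/
noncomputable def testLoss (c : Θ →₀ ℝ) (β : Θ → ℝ) (θ : Θ) (a : Fin 2) : ℝ :=
  1 / 2 + (SignType.sign (c θ) : ℝ) / 2 * (β θ - if a = 1 then 1 else 0)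

/-- The prior proportional to `|c|`. -/
noncomputable def testPrior (c : Θ →₀ ℝ) : Θ →₀ ℝ :=
  c.mapRange (fun w => |w| / c.sum fun _ w => |w|) (by simp)

theorem testLoss_mem_Icc {c : Θ →₀ ℝ} {β : Θ → ℝ} (hβ : ∀ θ, β θ ∈ Icc (0 : ℝ) 1) (θ : Θ)
    (a : Fin 2) : testLoss c β θ a ∈ Icc (0 : ℝ) 1 := by
  have hs : |(SignType.sign (c θ) : ℝ)| ≤ 1 := by
    rcases lt_trichotomy (c θ) 0 with h | h | h <;> simp [h]
  have hu : |β θ - if a = 1 then (1 : ℝ) else 0| ≤ 1 := by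
    have h := hβ θ
    rw [abs_le]
    split_ifs <;> constructor <;> linarith [h.1, h.2]
  have hsu := abs_le.1 ((abs_mul _ _).trans_le (mul_le_one₀ hs (abs_nonneg _) hu))
  rw [testLoss, mem_Icc]
  constructor <;> linarith [hsu.1, hsu.2]

theorem risk_testLoss (F : Experiment Θ Y) (c : Θ →₀ ℝ) (β : Θ → ℝ) (σ : Kernel Y (Fin 2))
    [IsMarkovKernel σ] (θ : Θ) :
    F.risk (testLoss c β) σ θ = 1 / 2 +
      (SignType.sign (c θ) : ℝ) / 2 * (β θ - ∫ y, (σ y).real {1} ∂F.law θ) := by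
  have := F.isProb θ
  have hinner : ∀ y, ∫ a, testLoss c β θ a ∂σ y = 1 / 2 +
      (SignType.sign (c θ) : ℝ) / 2 * (β θ - (σ y).real {1}) := fun y => by
    have h1 : (σ y).real {0} + (σ y).real {1} = 1 := by
      rw [← Fin.sum_univ_two (fun a => (σ y).real {a}), sum_measureReal_singleton]
      simp
    rw [integral_fintype Integrable.of_finite, Fin.sum_univ_two, eq_sub_of_add_eq h1]
    simp [testLoss]
    ring
  have hi : Integrable (fun y => (σ y).real {1}) (F.law θ) :=
    Integrable.of_bound (measurable_real_kernel σ 1).aestronglyMeasurable 1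
      (ae_of_all _ fun y => by
        rw [Real.norm_of_nonneg measureReal_nonneg]; exact measureReal_le_one)
  rw [risk]
  simp only [hinner]
  have hsub : Integrable (fun y => β θ - (σ y).real {1}) (F.law θ) := (integrable_const _).sub hi
  rw [integral_add (integrable_const _) (hsub.const_mul _),
    integral_const_mul, integral_sub (integrable_const _) hi]
  simp

theorem bayesRisk_testLoss (F : Experiment Θ Y) {c : Θ →₀ ℝ}
    (hc : 0 < c.sum fun _ w => |w|) (β : Θ → ℝ) (σ : Kernel Y (Fin 2)) [IsMarkovKernel σ] :
    F.bayesRisk (testLoss c β) (testPrior c) σ = 1 / 2 + (2 * c.sum fun _ w => |w|)⁻¹ *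
      ((c.sum fun θ w => w * β θ) - c.sum fun θ w => w * ∫ y, (σ y).real {1} ∂F.law θ) := by
  rw [bayesRisk, testPrior, Finsupp.sum_mapRange_index (by simp)]
  simp only [risk_testLoss]
  set K := c.sum fun _ w => |w| with hK
  have h1 : (c.sum fun _ w => |w| / K) = 1 := by
    simp only [Finsupp.sum, ← Finset.sum_div]
    exact div_self hc.ne'
  calc _ = 1 / 2 * (c.sum fun _ w => |w| / K) + (2 * K)⁻¹ *
      ((c.sum fun θ w => w * β θ) - c.sum fun θ w => w * ∫ y, (σ y).real {1} ∂F.law θ) := by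
        simp only [Finsupp.sum, ← Finset.sum_sub_distrib, Finset.mul_sum, ← Finset.sum_add_distrib]
        refine Finset.sum_congr rfl fun θ _ => ?_
        linear_combination (β θ - ∫ y, (σ y).real {1} ∂F.law θ) / (2 * K) * abs_mul_sign (c θ)
    _ = _ := by rw [h1, mul_one]

theorem testPrior_sum {c : Θ →₀ ℝ} (hc : 0 < c.sum fun _ w => |w|) :
    ((testPrior c).sum fun _ w => w) = 1 := by
  rw [testPrior, Finsupp.sum_mapRange_index (by simp)]
  simp only [Finsupp.sum, ← Finset.sum_div]
  exact div_self hc.ne'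

/-- A signed combination that separates events from tests based on `S` yields a decision problem won
by the full experiment. The rule is the optimal event for the combination; it is Bayes for the prior
proportional to `|c|`. The loss equalizes its risk, so that a gain in average risk is also a gain in
worst-case risk. -/
theorem beats_reduce_of_signed_gap {ν : Measure X} [IsFiniteMeasure ν]
    (hν : ∀ θ, E.law θ ≪ ν) {S : X → Y} (hS : Measurable S) {c : Θ →₀ ℝ} {η : ℝ} (hη : 0 < η)
    {B : Set X} (hB : MeasurableSet B)
    (hgap : ∀ φ : Y → ℝ, Measurable φ → (∀ y, φ y ∈ Icc (0 : ℝ) 1) →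
      (c.sum fun θ w => w * ∫ x, φ (S x) ∂E.law θ) + η ≤ c.sum fun θ w => w * (E.law θ).real B) :
    E.Beats (E.reduce S hS) := by
  classical
  have := E.isProb
  have hc : 0 < c.sum fun _ w => |w| := by
    obtain ⟨θ, hθ⟩ : c.support.Nonempty := by
      rw [Finsupp.support_nonempty_iff]
      rintro rfl
      have := hgap 0 measurable_const (by simp)
      simp only [Finsupp.sum_zero_index] at this
      linarith
    exact Finset.sum_pos (fun θ hθ => abs_pos.2 (Finsupp.mem_support_iff.1 hθ)) ⟨θ, hθ⟩
  obtain ⟨D, hD, hDopt⟩ := exists_optimal_set hν c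
  set K := c.sum fun _ w => |w| with hK
  have hBD : (c.sum fun θ w => w * (E.law θ).real B) ≤ c.sum fun θ w => w * (E.law θ).real D := by
    have h := hDopt (B.indicator fun _ => 1) (measurable_const.indicator hB) fun x => by
      by_cases hx : x ∈ B <;> simp [hx]
    simpa only [integral_indicator_const _ hB, smul_eq_mul, mul_one] using h
  let β : Θ → ℝ := fun θ => (E.law θ).real D
  have hβ : ∀ θ, β θ ∈ Icc (0 : ℝ) 1 := fun θ => ⟨measureReal_nonneg, measureReal_le_one⟩
  have hd : Measurable fun x => if x ∈ D then (1 : Fin 2) else 0 :=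
    Measurable.ite hD measurable_const measurable_const
  let ρ : Kernel X (Fin 2) := Kernel.deterministic _ hd
  have hρ : ∀ θ, ∫ x, (ρ x).real {1} ∂E.law θ = β θ := fun θ => by
    have : ∀ x, (ρ x).real {1} = D.indicator (fun _ => (1 : ℝ)) x := fun x => by
      by_cases hx : x ∈ D <;> simp [ρ, Kernel.deterministic_apply, measureReal_def, hx]
    simp only [this, integral_indicator_const _ hD, smul_eq_mul, mul_one, β]
  have hρrisk : ∀ θ, E.risk (testLoss c β) ρ θ = 1 / 2 := fun θ => by
    rw [risk_testLoss, hρ, sub_self, mul_zero, add_zero]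
  have hρbayes : E.bayesRisk (testLoss c β) (testPrior c) ρ = 1 / 2 := by
    rw [bayesRisk_testLoss E hc]
    simp only [hρ, sub_self, mul_zero, add_zero]
  have hπ : ∀ θ, testPrior c θ = |c θ| / K := fun θ => by rw [testPrior, Finsupp.mapRange_apply]
  have hπ0 : ∀ θ, 0 ≤ testPrior c θ := fun θ => by
    rw [hπ]; positivity
  have hopt : E.IsBayesRule (testLoss c β) (testPrior c) ρ := fun ρ' hρ' => by
    rw [hρbayes, bayesRisk_testLoss E hc]
    have h := hDopt _ (measurable_real_kernel ρ' 1) fun _ =>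
      ⟨measureReal_nonneg, measureReal_le_one⟩
    have : 0 ≤ (2 * K)⁻¹ := by positivity
    linarith [mul_nonneg this (sub_nonneg.2 h)]
  -- a prior-weighted average of risks below `r` stays below `r`
  have havg : ∀ (R : Θ → ℝ) (r : ℝ), (∀ θ, R θ ≤ r) →
      (∃ θ, 0 < testPrior c θ ∧ R θ < r) → ((testPrior c).sum fun θ w => w * R θ) < r := by
    rintro R r hR ⟨θ, hθ, hθr⟩
    calc ((testPrior c).sum fun θ w => w * R θ) < (testPrior c).sum fun _ w => w * r :=
          Finset.sum_lt_sum (fun θ _ => mul_le_mul_of_nonneg_left (hR θ) (hπ0 θ))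
            ⟨θ, Finsupp.mem_support_iff.2 hθ.ne', mul_lt_mul_of_pos_left hθr hθ⟩
      _ = r := by
        rw [← Finsupp.sum_mul, testPrior_sum hc, one_mul]
  have hpos : ∃ θ, 0 < testPrior c θ := by
    by_contra! h
    have h1 := testPrior_sum hc
    rw [show testPrior c = 0 from Finsupp.ext fun θ => le_antisymm (h θ) (hπ0 θ)] at h1
    simp at h1
  refine ⟨2, testLoss c β, testLoss_mem_Icc hβ, testPrior c, ρ, 1 / 2, (2 * K)⁻¹ * η,
    hπ0, testPrior_sum hc, inferInstance, hopt, ?_, by positivity, fun θ => (hρrisk θ).le,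
    fun σ hσ => ?_⟩
  · -- outside the support of the prior the loss is constant, so a dominating rule would
    -- improve on the Bayes risk
    rintro ⟨ρ', hρ', hle, θ, hlt⟩
    simp only [hρrisk] at hle hlt
    have hcθ : c θ ≠ 0 := fun h0 => by
      rw [risk_testLoss, h0] at hlt
      simp at hlt
    refine absurd (hopt ρ' hρ') (not_le.2 ?_)
    rw [hρbayes]
    exact havg _ _ hle ⟨θ, by rw [hπ]; positivity, hlt⟩
  · have hbayes : E.bayesRisk (testLoss c β) (testPrior c) ρ + (2 * K)⁻¹ * η ≤
        (E.reduce S hS).bayesRisk (testLoss c β) (testPrior c) σ := by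
      have hmap : ∀ θ, ∫ y, (σ y).real {1} ∂(E.reduce S hS).law θ =
          ∫ x, (σ (S x)).real {1} ∂E.law θ := fun θ =>
        integral_map hS.aemeasurable (measurable_real_kernel σ 1).aestronglyMeasurable
      rw [hρbayes, bayesRisk_testLoss _ hc]
      simp only [hmap]
      have h := hgap _ (measurable_real_kernel σ 1) fun _ =>
        ⟨measureReal_nonneg, measureReal_le_one⟩
      gcongr
      linarith
    refine ⟨?_, hbayes⟩
    by_contra! hlt
    obtain ⟨θ, hθ⟩ := hpos
    refine absurd hbayes (not_le.2 ?_)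
    rw [hρbayes]
    exact havg _ _ (fun θ => (hlt θ).le) ⟨θ, hθ, hlt θ⟩

theorem beats_reduce_of_not_isSufficient {𝒯 𝒰 : Type*} [m𝒯 : MeasurableSpace 𝒯]
    [m𝒰 : MeasurableSpace 𝒰] {s : ℕ → Θ} (hν : ∀ θ, E.law θ ≪ E.mixture s) {T : X → 𝒯}
    (hT : Measurable T) (hns : ¬ E.IsSufficient T) {S : X → 𝒰} (hS : Measurable S)
    (hST : m𝒰.comap S ≤ m𝒯.comap T) : E.Beats (E.reduce S hS) := by
  obtain ⟨c, η, B, hη, hB, hgap⟩ := exists_signed_gap hT.comap_le hν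
    fun h => hns (h.isSufficient hT hν)
  exact beats_reduce_of_signed_gap hν hS hη hB fun φ hφ hφ1 =>
    hgap (φ ∘ S) (hφ.comp ((comap_measurable S).mono hST le_rfl)) fun x => hφ1 (S x)

end Decision

end Experiment

theorem mainTheorem5 {Θ X 𝒯 𝒮 : Type*} [Nonempty Θ]
    [MeasurableSpace X] [m𝒯 : MeasurableSpace 𝒯] [m𝒮 : MeasurableSpace 𝒮]
    (E : Experiment Θ X) (hE : E.IsDominated)
    (T : X → 𝒯) (hT : Measurable T)
    (S : X → 𝒮) (hS : Measurable S)
    (hST : MeasurableSpace.comap S m𝒮 ≤ MeasurableSpace.comap T m𝒯) :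
    -- deficiency zero characterizes sufficiency
    (Experiment.deficiency (E.reduce T hT) E = 0 ↔ E.IsSufficient T) ∧
    -- Blackwell sufficiency of `T` is Blackwell equivalence of the two experiments
    (E.IsBlackwellSufficient T hT ↔ (E.reduce T hT).BlackwellEquivalent E) ∧
    -- on standard Borel sample spaces the two notions of sufficiency agree
    (StandardBorelSpace X → (E.IsBlackwellSufficient T hT ↔ E.IsSufficient T)) ∧
    -- nonsufficiency forces positive deficiency and a strictly suboptimal decision problem,
    -- for `T` and for every statistic `S` measurable with respect to the sigma-field of `T`
    ((¬ E.IsSufficient T ∨ (StandardBorelSpace X ∧ ¬ E.IsBlackwellSufficient T hT)) →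
      0 < Experiment.deficiency (E.reduce T hT) E ∧
      E.Beats (E.reduce T hT) ∧
      0 < Experiment.deficiency (E.reduce S hS) E ∧
      E.Beats (E.reduce S hS)) := by
  obtain ⟨s, hs⟩ := hE.exists_seq
  have hν : ∀ θ, E.law θ ≪ E.mixture s := fun θ =>
    Measure.AbsolutelyContinuous.mk fun A hA hA0 =>
      hs A hA ((Experiment.mixture_apply_eq_zero hA).1 hA0) θ
  have hX : Nonempty X := by
    obtain ⟨θ⟩ := ‹Nonempty Θ›
    have := E.isProb θ
    exact nonempty_of_isProbabilityMeasure (E.law θ)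
  have hdef : Experiment.deficiency (E.reduce T hT) E = 0 ↔ E.IsSufficient T := by
    refine ⟨fun h0 => ?_, fun hsuff => ?_⟩
    · by_contra hns
      exact (Experiment.beats_reduce_of_not_isSufficient hν hT hns hT le_rfl).deficiency_pos.ne' h0
    · refine Experiment.deficiency_eq_zero_of_forall_exists_bind_eq fun k ρ hρ => ?_
      -- the action set is nonempty because `ρ` is Markov and the sample space is nonempty
      obtain ⟨x⟩ := hX
      have := nonempty_of_isProbabilityMeasure (ρ x)
      exact (hsuff.hasMeasurableDensities hT hν).exists_bind_eq hT hν ρ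
  have hBS : StandardBorelSpace X → (E.IsBlackwellSufficient T hT ↔ E.IsSufficient T) := by
    intro hXB
    refine ⟨fun h => hdef.1 h.deficiency_eq_zero, fun hsuff => ?_⟩
    obtain ⟨κ, hκ, hκE⟩ :=
      (hsuff.hasMeasurableDensities hT hν).exists_bind_eq hT hν (Kernel.id : Kernel X X)
    exact ⟨κ, hκ, fun θ => (hκE θ).trans Measure.id_comp⟩
  refine ⟨hdef, ⟨fun h => ⟨Experiment.reduce_isGarblingOf hT, h⟩, fun h => h.2⟩, hBS, fun h => ?_⟩
  have hns : ¬ E.IsSufficient T := h.elim id fun h' => fun hsuff => h'.2 ((hBS h'.1).2 hsuff)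
  have hbT := Experiment.beats_reduce_of_not_isSufficient hν hT hns hT le_rfl
  have hbS := Experiment.beats_reduce_of_not_isSufficient hν hT hns hS hST
  exact ⟨hbT.deficiency_pos, hbT, hbS.deficiency_pos, hbS⟩
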